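/- A hypergraph is a triple $G=(V,E,f)$ with finite sets $V=V(G)$ of vertices and $E=E(G)$ of edges and a map $f=f_G\colon E\to\mathcal P(V)\setminus\{\emptyset\}$; it is simple if $f$ is injective. Its incidence graph has vertex set $V\mathbin{\dot\cup}E$ and an edge between $v\in V$ and $e\in E$ whenever $v\in f(e)$ (and no other edges); $G$ is connected, respectively Berge-acyclic, if its incidence graph is connected, respectively acyclic. A homomorphism from $F$ to $G$ is a pair of maps $h_V\colon V(F)\to V(G)$, $h_E\colon E(F)\to E(G)$ with $h_V(f_F(e))=f_G(h_E(e))$ for every $e\in E(F)$, and $\mathsf{Hom}(F,G)$ is the number of such pairs. Colour refinement sets $c_G^0(v)=1$ and $$c_G^{i+1}(v)=\{\!\{\,\{\!\{c_G^i(u) : u\in f_G(e)\}\!\} : e\in E(G),\ v\in f_G(e)\,\}\!\}$$ for all $v\in V(G)$ and $i\ge 0$ (with $\{\!\{\cdot\}\!\}$ denoting multisets). It distinguishes $G$ and $H$ if $\{\!\{c_G^i(v): v\in V(G)\}\!\}\neq\{\!\{c_H^i(v): v\in V(H)\}\!\}$ for some $i\ge 0$. Corollary. For all simple hypergraphs $G$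 and $H$, the following are equivalent: 1. $\mathsf{Hom}(B,G)=\mathsf{Hom}(B,H)$ for every connected Berge-acyclic simple hypergraph $B$. 2. Colour refinement does not distinguish $G$ and $H$. -/

import Mathlib

/-- A hypergraph `(V, E, f)`, possibly with parallel edges: `inc` is the incidence function `f`,
which assigns a non-empty set of vertices to every edge. -/
structure IncHypergraph (V : Type*) (E : Type*) where
  inc : E → Finset V
  inc_nonempty : ∀ e, (inc e).Nonempty

namespace IncHypergraph

/-- A hypergraph is simple if it has no parallel edges. -/
def IsSimple {V E : Type*} (G : IncHypergraph V E) : Prop :=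
  Function.Injective G.inc

/-- The incidence graph: the bipartite graph on the disjoint union of vertices and edges in which
`v` and `e` are adjacent if and only if `v ∈ f e`. -/
def incidenceGraph {V E : Type*} (G : IncHypergraph V E) : SimpleGraph (V ⊕ E) where
  Adj x y := (∃ v e, v ∈ G.inc e ∧ x = Sum.inl v ∧ y = Sum.inr e) ∨
    (∃ v e, v ∈ G.inc e ∧ x = Sum.inr e ∧ y = Sum.inl v)
  symm := ⟨by
    rintro x y (⟨v, e, h, rfl, rfl⟩ | ⟨v, e, h, rfl, rfl⟩)
    · exact Or.inr ⟨v, e, h, rfl, rfl⟩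
    · exact Or.inl ⟨v, e, h, rfl, rfl⟩⟩
  loopless := ⟨by
    rintro x (⟨v, e, _, rfl, h⟩ | ⟨v, e, _, rfl, h⟩)
    · cases h
    · cases h⟩

/-- A hypergraph is connected if its incidence graph is connected. -/
def IsConnected {V E : Type*} (G : IncHypergraph V E) : Prop :=
  G.incidenceGraph.Connected

/-- A hypergraph is Berge-acyclic if its incidence graph is acyclic. -/
def IsBergeAcyclic {V E : Type*} (G : IncHypergraph V E) : Prop :=
  G.incidenceGraph.IsAcyclic

/-- A homomorphism from `F` to `G`: a pair of maps on vertices and on edges such that the image of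
the vertex set of every edge `e` of `F` is exactly the vertex set of the image edge. -/
@[ext]
structure Hom {V E V' E' : Type*} (F : IncHypergraph V E) (G : IncHypergraph V' E') where
  onV : V → V'
  onE : E → E'
  image_inc : ∀ e, onV '' (F.inc e : Set V) = (G.inc (onE e) : Set V')

/-- The number of homomorphisms from `F` to `G`. -/
noncomputable def homCount {V E V' E' : Type*} (F : IncHypergraph V E)
    (G : IncHypergraph V' E') : ℕ :=
  Nat.card (Hom F G)

/-- The colours that can occur in round `i` of colour refinement: a single colour in round `0`, and
multisets of multisets of colours of the previous round afterwards. -/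
def Color : ℕ → Type
  | 0 => Unit
  | i + 1 => Multiset (Multiset (Color i))

open Classical in
/-- Colour refinement on a hypergraph: the colour of `v` in round `i + 1` is the multiset, over all
edges `e` containing `v`, of the multiset of the round-`i` colours of the vertices of `e`. -/
noncomputable def color {V E : Type*} [Fintype E] (G : IncHypergraph V E) :
    (i : ℕ) → V → Color i
  | 0 => fun _ => ()
  | i + 1 => fun v =>
      (Finset.univ.filter (fun e : E => v ∈ G.inc e)).val.map
        (fun e => (G.inc e).val.map (G.color i))

/-- Colour refinement distinguishes `G` and `H` if in some round the multisets of the colours of all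
vertices differ. -/
def CRDistinguishes {V E V' E' : Type*} [Fintype V] [Fintype E] [Fintype V'] [Fintype E']
    (G : IncHypergraph V E) (H : IncHypergraph V' E') : Prop :=
  ∃ i : ℕ, (Finset.univ : Finset V).val.map (G.color i) ≠
    (Finset.univ : Finset V').val.map (H.color i)

end IncHypergraph

/-! Hom counts are written as sums over vertex maps `h`, each edge `e` contributing the multiplicity
of `h(e)` as an edge of the target (`homCount_eq_sum`).

If colour refinement does not distinguish `G` and `H`, compare these sums with vertex weights
depending only on the round-`i` colour. Acyclicity yields an edge meeting the remaining ones in at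
most one vertex `v`. Summing over its images turns it into a weight at `v` depending only on the
round-`(i+1)` colour (`weightedSum_insert`, `edgeSum_congr`). Once all edges are peeled off, a
colour-preserving bijection of the vertices identifies the two sums (`weightedSum_congr`).

Conversely, let `K` be the disjoint union of `G` and `H`, and consider the functions on its vertices
that count homomorphisms from rooted tree hypergraphs. They are closed under products, so their span
is an algebra and contains the indicators of the classes they separate
(`indicator_mem_span_treeFunction`). The span is closed under attaching an edge, so edge sums of
class indicators are constant on classes. A triangular system then shows that the classes form an
equitable partition (`edgeCount_eq_of_edgeSum_eq`), hence they refine every round of colours. Equal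
hom counts force every function in the span to have equal sums over `G` and over `H`, in particular
the class indicators. So classes, and therefore colours, occur equally often on both sides.

The trees built this way may have parallel edges; merging these does not change hom counts into
simple targets (`homCount_simplification`). -/

namespace IncHypergraph

open Finset Classical

/-! ### Hom counts as sums over vertex maps -/

section Multiplicity

variable {V E X F : Type*} [Fintype V] [Fintype E] [Fintype X] [Fintype F]

/-- The number of edges with vertex set `A`. -/
noncomputable def mult (G : IncHypergraph X F) (A : Finset X) : ℚ :=
  ∑ g : F, if G.inc g = A then 1 else 0

/-- Homomorphisms as pairs of a vertex map and a choice of an image edge for every edge. -/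
noncomputable def homEquiv (B : IncHypergraph V E) (G : IncHypergraph X F) :
    Hom B G ≃ Σ h : V → X, ∀ e : E, {g : F // G.inc g = (B.inc e).image h} where
  toFun f := ⟨f.onV, fun e => ⟨f.onE e, by
    apply Finset.coe_injective
    rw [Finset.coe_image, f.image_inc]⟩⟩
  invFun p := ⟨p.1, fun e => (p.2 e).1, fun e => by
    rw [(p.2 e).2, Finset.coe_image]⟩
  left_inv _ := rfl
  right_inv _ := rfl

theorem homCount_eq_sum (B : IncHypergraph V E) (G : IncHypergraph X F) :
    (B.homCount G : ℚ) = ∑ h : V → X, ∏ e, G.mult ((B.inc e).image h) := by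
  rw [homCount, Nat.card_congr (homEquiv B G), Nat.card_eq_fintype_card, Fintype.card_sigma]
  push_cast
  refine Finset.sum_congr rfl fun h _ => ?_
  rw [Fintype.card_pi]
  push_cast
  refine Finset.prod_congr rfl fun e _ => ?_
  rw [Fintype.card_subtype, mult, Finset.sum_boole]

end Multiplicity

/-! ### Merging parallel edges -/

section Simplification

variable {V E X F : Type*}

/-- The simple hypergraph obtained by merging parallel edges. -/
def simplification (B : IncHypergraph V E) : IncHypergraph V (Set.range B.inc) where
  inc A := A.1
  inc_nonempty := by
    rintro ⟨_, e, rfl⟩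
    exact B.inc_nonempty e

theorem simplification_isSimple (B : IncHypergraph V E) : B.simplification.IsSimple :=
  Subtype.val_injective

theorem incidenceGraph_adj_inl_inr (B : IncHypergraph V E) (v : V) (e : E) :
    B.incidenceGraph.Adj (Sum.inl v) (Sum.inr e) ↔ v ∈ B.inc e := by
  constructor
  · rintro (⟨v', e', h, h1, h2⟩ | ⟨v', e', h, h1, h2⟩)
    · cases h1; cases h2; exact h
    · cases h1
  · exact fun h => Or.inl ⟨v, e, h, rfl, rfl⟩

theorem incidenceGraph_adj_inr_inl (B : IncHypergraph V E) (v : V) (e : E) :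
    B.incidenceGraph.Adj (Sum.inr e) (Sum.inl v) ↔ v ∈ B.inc e := by
  rw [SimpleGraph.adj_comm, incidenceGraph_adj_inl_inr]

/-- A map of vertices and a map of edges preserving incidence induce a homomorphism of the
incidence graphs. -/
def incidenceHom {V' E' : Type*} (B : IncHypergraph V E) (B' : IncHypergraph V' E')
    (a : V → V') (b : E → E') (hab : ∀ v e, v ∈ B.inc e → a v ∈ B'.inc (b e)) :
    B.incidenceGraph →g B'.incidenceGraph where
  toFun := Sum.map a b
  map_rel' := by
    rintro _ _ (⟨v, e, h, rfl, rfl⟩ | ⟨v, e, h, rfl, rfl⟩)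
    · exact (incidenceGraph_adj_inl_inr _ _ _).2 (hab v e h)
    · exact (incidenceGraph_adj_inr_inl _ _ _).2 (hab v e h)

theorem IsConnected.simplification {B : IncHypergraph V E} (hB : B.IsConnected) :
    B.simplification.IsConnected := by
  refine SimpleGraph.Connected.map
    (incidenceHom B B.simplification id (fun e => ⟨B.inc e, e, rfl⟩) fun v e h => h) ?_ hB
  rintro (v | ⟨_, e, rfl⟩)
  · exact ⟨Sum.inl v, rfl⟩
  · exact ⟨Sum.inr e, rfl⟩

/-- Choosing one representative from each class of parallel edges embeds the new incidence graph
into the old one. -/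
theorem IsBergeAcyclic.simplification {B : IncHypergraph V E} (hB : B.IsBergeAcyclic) :
    B.simplification.IsBergeAcyclic := by
  refine SimpleGraph.IsAcyclic.comap
    (incidenceHom B.simplification B id (fun A => A.2.choose) fun v A h => ?_) ?_ hB
  · rw [A.2.choose_spec]
    exact h
  · refine Function.Injective.sumMap Function.injective_id fun A A' h => ?_
    apply Subtype.ext
    rw [← A.2.choose_spec, ← A'.2.choose_spec]
    exact congrArg B.inc h

/-- In a simple target the vertex map determines the image of every edge, so parallel edges have the
same image. -/
theorem homCount_simplification (B : IncHypergraph V E) {G : IncHypergraph X F}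
    (hG : G.IsSimple) : B.simplification.homCount G = B.homCount G := by
  refine Nat.card_congr
    { toFun := fun f => ⟨f.onV, fun e => f.onE ⟨B.inc e, e, rfl⟩, fun e => f.image_inc ⟨B.inc e, e, rfl⟩⟩
      invFun := fun f => ⟨f.onV, fun A => f.onE A.2.choose, fun A => ?_⟩
      left_inv := fun f => ?_
      right_inv := fun f => ?_ }
  · rw [← f.image_inc, A.2.choose_spec]
    rfl
  · ext x
    · rfl
    · dsimp
      congr 2
      exact x.2.choose_spec
  · ext e
    · rfl
    · apply hG
      apply Finset.coe_injective
      dsimp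
      have h : ∃ y, B.inc y = B.inc e := ⟨e, rfl⟩
      rw [← f.image_inc, ← f.image_inc, h.choose_spec]

end Simplification

/-! ### Colour-preserving bijections -/

section ColorPreservingEquiv

theorem exists_equiv_of_map_univ_eq {α β γ : Type*} [Fintype α] [Fintype β] (f : α → γ)
    (g : β → γ) (h : (univ : Finset α).val.map f = (univ : Finset β).val.map g) :
    ∃ σ : α ≃ β, ∀ a, g (σ a) = f a := by
  have hc : ∀ c, Nonempty ({a // f a = c} ≃ {b // g b = c}) := by
    intro c
    rw [← Fintype.card_eq, Fintype.card_subtype, Fintype.card_subtype]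
    have := congrArg (Multiset.count c) h
    rw [Multiset.count_map, Multiset.count_map] at this
    simpa [Finset.card, Finset.filter_val, eq_comm] using this
  let τ := fun c => (hc c).some
  refine ⟨((Equiv.sigmaFiberEquiv f).symm.trans (Equiv.sigmaCongrRight τ)).trans
    (Equiv.sigmaFiberEquiv g), fun a => ?_⟩
  exact (τ (f a) ⟨a, rfl⟩).2

theorem exists_equiv_of_map_eq {α β γ : Type*} (s : Finset α) (t : Finset β) (f : α → γ)
    (g : β → γ) (h : s.val.map f = t.val.map g) :
    ∃ σ : s ≃ t, ∀ a, g (σ a) = f a := by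
  apply exists_equiv_of_map_univ_eq (fun a : s => f a) (fun b : t => g b)
  exact (Multiset.attach_map_val' s.val f).trans
    (h.trans (Multiset.attach_map_val' t.val g).symm)

/-- Splitting into `z`, the rest of `D` and the complement of `D` shows that the marked colours
depend only on `d z` and the colour multisets of `D` and of the whole type. -/
theorem map_univ_marked {Z C : Type*} [Fintype Z] (d : Z → C) (D : Finset Z) (z : Z)
    (hz : z ∈ D) :
    (univ : Finset Z).val.map (fun w => (d w, w ∈ D, w = z)) =
      (d z, True, True) ::ₘ ((D.val.map d).erase (d z)).map (fun c => (c, True, False)) +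
      ((univ : Finset Z).val.map d - D.val.map d).map (fun c => (c, False, False)) := by
  have h1 : (univ : Finset Z).val = z ::ₘ (D.erase z).val + (Dᶜ).val := by
    rw [Finset.erase_val, Multiset.cons_erase hz,
      ← Finset.disjUnion_val _ _ (disjoint_compl_right (a := D))]
    simp
  have h2 : (D.val.map d).erase (d z) = (D.erase z).val.map d := by
    rw [Finset.erase_val, Multiset.map_erase_of_mem _ _ hz]
  have h3 : (univ : Finset Z).val.map d - D.val.map d = Dᶜ.val.map d := by
    have : (univ : Finset Z).val = D.val + Dᶜ.val := by
      rw [← Finset.disjUnion_val _ _ (disjoint_compl_right (a := D))]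
      simp
    rw [this, Multiset.map_add, add_tsub_cancel_left]
  rw [h2, h3, h1, Multiset.map_add, Multiset.map_cons, Multiset.map_map, Multiset.map_map]
  congr 1
  · congr 1
    · simp [hz]
    · refine Multiset.map_congr rfl fun w hw => ?_
      have := Finset.mem_erase.1 hw
      simp [this.1, this.2]
  · refine Multiset.map_congr rfl fun w hw => ?_
    have hw' : w ∉ D := by simpa using hw
    have : w ≠ z := fun h => hw' (h ▸ hz)
    simp [hw', this]

/-- A colour-preserving bijection which respects a marked set and a marked point in it. -/
theorem exists_equiv_image {X Y C : Type*} [Fintype X] [Fintype Y] (c : X → C) (c' : Y → C)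
    (huniv : (univ : Finset X).val.map c = (univ : Finset Y).val.map c')
    {A : Finset X} {A' : Finset Y} (hA : A.val.map c = A'.val.map c') {x : X} {y : Y}
    (hx : x ∈ A) (hy : y ∈ A') (hxy : c x = c' y) :
    ∃ σ : X ≃ Y, (∀ z, c' (σ z) = c z) ∧ σ x = y ∧ A.image σ = A' := by
  obtain ⟨σ, hσ⟩ := exists_equiv_of_map_univ_eq (fun w => (c w, w ∈ A, w = x))
    (fun w => (c' w, w ∈ A', w = y)) (by rw [map_univ_marked c A x hx, map_univ_marked c' A' y hy, hA, huniv, hxy])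
  simp only [Prod.mk.injEq, eq_iff_iff] at hσ
  refine ⟨σ, fun z => (hσ z).1, ((hσ x).2.2.2 rfl), ?_⟩
  ext w
  rw [Finset.mem_image]
  constructor
  · rintro ⟨z, hz, rfl⟩
    exact (hσ z).2.1.2 hz
  · intro hw
    refine ⟨σ.symm w, (hσ _).2.1.1 ?_, ?_⟩ <;> simp [hw]

end ColorPreservingEquiv

/-! ### Summing over the images of a single edge -/

section EdgeSum

variable {V X F Y F' C : Type*} [Fintype V] [Fintype X] [Fintype F] [Fintype Y] [Fintype F']

/-- The weighted number of maps with `v ↦ x` under which the image of `e` is `A`. -/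
noncomputable def coverSum (A : Finset X) (e : Finset V) (v : V) (w : V → X → ℚ) (x : X) : ℚ :=
  ∑ h : V → X, if h v = x ∧ e.image h = A then ∏ u ∈ e, w u (h u) else 0

/-- The weighted number of maps with `v ↦ x` under which the image of `e` is an edge. -/
noncomputable def edgeSum (G : IncHypergraph X F) (e : Finset V) (v : V) (w : V → X → ℚ)
    (x : X) : ℚ :=
  ∑ h : V → X, if h v = x then (∏ u ∈ e, w u (h u)) * G.mult (e.image h) else 0

theorem edgeSum_eq_sum_coverSum (G : IncHypergraph X F) {e : Finset V} {v : V} (hv : v ∈ e)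
    (w : V → X → ℚ) (x : X) :
    G.edgeSum e v w x = ∑ g with x ∈ G.inc g, coverSum (G.inc g) e v w x := by
  have h1 : G.edgeSum e v w x = ∑ g, coverSum (G.inc g) e v w x := by
    unfold edgeSum coverSum
    rw [Finset.sum_comm]
    refine Finset.sum_congr rfl fun h _ => ?_
    by_cases hx : h v = x
    · simp only [hx, true_and, if_true, mult, Finset.mul_sum, mul_ite, mul_one, mul_zero]
      exact Finset.sum_congr rfl fun g _ => if_congr eq_comm rfl rfl
    · simp [hx]
  rw [h1, eq_comm]
  refine Finset.sum_filter_of_ne fun g _ hg => ?_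
  by_contra hx
  refine hg (Finset.sum_eq_zero fun h _ => if_neg ?_)
  rintro ⟨rfl, h2⟩
  exact hx (h2 ▸ Finset.mem_image_of_mem h hv)

/-- Composition with a colour-preserving bijection taking `A` to `A'` and `x` to `y` matches the
summands. It has to be defined on all of `X`, since the maps are also summed over their values
outside `e`. -/
theorem coverSum_congr (c : X → C) (c' : Y → C)
    (huniv : (univ : Finset X).val.map c = (univ : Finset Y).val.map c')
    {A : Finset X} {A' : Finset Y} (hA : A.val.map c = A'.val.map c') {x : X} {y : Y}
    (hx : x ∈ A) (hy : y ∈ A') (hxy : c x = c' y) (e : Finset V) (v : V) {w : V → X → ℚ}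
    {w' : V → Y → ℚ} (hw : ∀ u a b, c a = c' b → w u a = w' u b) :
    coverSum A e v w x = coverSum A' e v w' y := by
  obtain ⟨σ, hσ, rfl, rfl⟩ := exists_equiv_image c c' huniv hA hx hy hxy
  refine Fintype.sum_equiv (Equiv.arrowCongr (Equiv.refl V) σ) _ _ fun h => ?_
  have h1 : e.image (σ ∘ h) = A.image σ ↔ e.image h = A := by
    rw [← Finset.image_image]
    exact (Finset.image_injective σ.injective).eq_iff
  have h2 : (Equiv.arrowCongr (Equiv.refl V) σ) h = σ ∘ h := rfl
  rw [h2]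
  refine if_congr (and_congr σ.apply_eq_iff_eq.symm h1.symm) ?_ rfl
  exact Finset.prod_congr rfl fun u _ => hw u _ _ (hσ _).symm

/-- The key step of refinement: `hedge` pairs the edges at `x` with edges at `y` of the same colour
multiset, and paired edges contribute equally. -/
theorem edgeSum_congr (G : IncHypergraph X F) (H : IncHypergraph Y F') (c : X → C) (c' : Y → C)
    (huniv : (univ : Finset X).val.map c = (univ : Finset Y).val.map c') {x : X} {y : Y}
    (hxy : c x = c' y)
    (hedge : (univ.filter (fun g => x ∈ G.inc g)).val.map (fun g => (G.inc g).val.map c) =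
      (univ.filter (fun g => y ∈ H.inc g)).val.map (fun g => (H.inc g).val.map c'))
    {e : Finset V} {v : V} (hv : v ∈ e) {w : V → X → ℚ}
    {w' : V → Y → ℚ} (hw : ∀ u a b, c a = c' b → w u a = w' u b) :
    G.edgeSum e v w x = H.edgeSum e v w' y := by
  rw [edgeSum_eq_sum_coverSum G hv, edgeSum_eq_sum_coverSum H hv, ← Finset.sum_coe_sort,
    ← Finset.sum_coe_sort (univ.filter (fun g => y ∈ H.inc g))]
  obtain ⟨τ, hτ⟩ := exists_equiv_of_map_eq _ _ _ _ hedge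
  refine Fintype.sum_equiv τ _ _ fun g => ?_
  exact coverSum_congr c c' huniv (hτ g).symm (Finset.mem_filter.1 g.2).2
    (Finset.mem_filter.1 (τ g).2).2 hxy e v hw

end EdgeSum

/-! ### Later rounds refine earlier ones -/

section Color

/-- The colour in the previous round. -/
def Color.prev : (i : ℕ) → Color (i + 1) → Color i
  | 0 => fun _ => ()
  | i + 1 => Multiset.map (Multiset.map (Color.prev i))

theorem prev_color {X F : Type*} [Fintype F] (G : IncHypergraph X F) (i : ℕ) (x : X) :
    Color.prev i (G.color (i + 1) x) = G.color i x := by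
  induction i generalizing x with
  | zero => rfl
  | succ i ih =>
    have : Color.prev i ∘ G.color (i + 1) = G.color i := funext ih
    change Multiset.map (Multiset.map (Color.prev i)) (Multiset.map _ _) = Multiset.map _ _
    rw [Multiset.map_map]
    refine Multiset.map_congr rfl fun e _ => ?_
    rw [Function.comp_apply, Multiset.map_map, this]

theorem color_eq_of_color_succ_eq {X F Y F' : Type*} [Fintype F] [Fintype F']
    {G : IncHypergraph X F} {H : IncHypergraph Y F'} {i : ℕ} {x : X} {y : Y}
    (h : G.color (i + 1) x = H.color (i + 1) y) : G.color i x = H.color i y := by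
  rw [← prev_color G, ← prev_color H, h]

end Color

/-! ### Peeling off leaf edges -/

section WeightedSum

variable {V E X F Y F' : Type*} [Fintype V] [Fintype X] [Fintype F] [Fintype Y]
  [Fintype F']

/-- The weighted number of vertex maps under which the images of all edges in `S` are edges. -/
noncomputable def weightedSum (B : IncHypergraph V E) (G : IncHypergraph X F) (S : Finset E)
    (w : V → X → ℚ) : ℚ :=
  ∑ h : V → X, (∏ u, w u (h u)) * ∏ e ∈ S, G.mult ((B.inc e).image h)

/-- The weights obtained by summing over the images of an edge `e` attached at `v`. -/
noncomputable def peelWeight (G : IncHypergraph X F) (e : Finset V) (v : V) (w : V → X → ℚ) :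
    V → X → ℚ :=
  fun u x => if u = v then G.edgeSum e v w x else if u ∈ e then 1 else w u x

theorem sum_apply_eq (v : V) (x : X) :
    (∑ b : V → X, if b v = x then (1 : ℚ) else 0) = Fintype.card ({u // u ≠ v} → X) := by
  rw [Fintype.sum_equiv (Equiv.funSplitAt v X) _ (fun p => if p.1 = x then (1 : ℚ) else 0)
    (fun b => by simp), Fintype.sum_prod_type_right]
  simp

theorem prod_peelWeight (G : IncHypergraph X F) {e : Finset V} {v : V} (hv : v ∈ e)
    (w : V → X → ℚ) (h : V → X) :
    ∏ u, peelWeight G e v w u (h u) = G.edgeSum e v w (h v) * ∏ u ∈ eᶜ, w u (h u) := by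
  rw [← Finset.prod_mul_prod_compl e]
  congr 1
  · rw [Finset.prod_eq_single_of_mem v hv]
    · simp [peelWeight]
    · intro u hu huv
      simp [peelWeight, hu, huv]
  · refine Finset.prod_congr rfl fun u hu => ?_
    have hu' : u ∉ e := by simpa using hu
    have huv : u ≠ v := fun h => hu' (h ▸ hv)
    simp [peelWeight, hu', huv]

/-- Exchanging the values of two maps on `e`. -/
noncomputable def swapOn (e : Finset V) : (V → X) × (V → X) ≃ (V → X) × (V → X) where
  toFun p := (e.piecewise p.1 p.2, e.piecewise p.2 p.1)
  invFun p := (e.piecewise p.1 p.2, e.piecewise p.2 p.1)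
  left_inv p := by
    ext u <;> by_cases hu : u ∈ e <;> simp [hu]
  right_inv p := by
    ext u <;> by_cases hu : u ∈ e <;> simp [hu]

/-- Both sides count pairs of maps agreeing at `v`. On the left one map carries all edges and the
other is free; on the right one carries `e` and the other carries `S`. Swapping values on `e`
exchanges the two descriptions, as edges in `S` meet `e` at most in `v`. The factor compensates for
the free values. -/
theorem weightedSum_insert (B : IncHypergraph V E) (G : IncHypergraph X F) {S : Finset E} {e : E}
    (he : e ∉ S) {v : V} (hv : v ∈ B.inc e)
    (hS : ∀ e' ∈ S, ∀ u ∈ B.inc e', u ∈ B.inc e → u = v) (w : V → X → ℚ) :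
    Fintype.card ({u // u ≠ v} → X) * B.weightedSum G (insert e S) w =
      B.weightedSum G S (peelWeight G (B.inc e) v w) := by
  have hL : (Fintype.card ({u // u ≠ v} → X) : ℚ) * B.weightedSum G (insert e S) w =
      ∑ p : (V → X) × (V → X), if p.2 v = p.1 v then (∏ u, w u (p.1 u)) *
        (G.mult ((B.inc e).image p.1) * ∏ e ∈ S, G.mult ((B.inc e).image p.1)) else 0 := by
    rw [Fintype.sum_prod_type, weightedSum, Finset.mul_sum]
    refine Finset.sum_congr rfl fun a _ => ?_
    rw [← sum_apply_eq v (a v), Finset.sum_mul, Finset.prod_insert he]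
    refine Finset.sum_congr rfl fun b _ => ?_
    simp
  have hR : B.weightedSum G S (peelWeight G (B.inc e) v w) =
      ∑ p : (V → X) × (V → X), if p.1 v = p.2 v then
        ((∏ u ∈ B.inc e, w u (p.1 u)) * G.mult ((B.inc e).image p.1)) *
        (∏ u ∈ (B.inc e)ᶜ, w u (p.2 u)) * ∏ e ∈ S, G.mult ((B.inc e).image p.2) else 0 := by
    rw [Fintype.sum_prod_type_right, weightedSum]
    refine Finset.sum_congr rfl fun b _ => ?_
    rw [prod_peelWeight G hv, edgeSum, Finset.sum_mul, Finset.sum_mul]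
    refine Finset.sum_congr rfl fun a _ => ?_
    simp only [ite_mul, zero_mul]
  rw [hL, hR, eq_comm]
  refine Fintype.sum_equiv (swapOn (B.inc e)) _ _ fun p => ?_
  obtain ⟨a, b⟩ := p
  simp only [swapOn, Equiv.coe_fn_mk, Finset.piecewise_eq_of_mem _ _ _ hv]
  by_cases hab : a v = b v
  · rw [if_pos hab, if_pos hab.symm, ← Finset.prod_mul_prod_compl (B.inc e)]
    have h1 : ∏ u ∈ B.inc e, w u ((B.inc e).piecewise a b u) = ∏ u ∈ B.inc e, w u (a u) :=
      Finset.prod_congr rfl fun u hu => by simp [hu]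
    have h2 : ∏ u ∈ (B.inc e)ᶜ, w u ((B.inc e).piecewise a b u) =
        ∏ u ∈ (B.inc e)ᶜ, w u (b u) :=
      Finset.prod_congr rfl fun u hu => by
        have : u ∉ B.inc e := by simpa using hu
        simp [this]
    have h3 : (B.inc e).image ((B.inc e).piecewise a b) = (B.inc e).image a :=
      Finset.image_congr fun u hu => by
        have : u ∈ B.inc e := hu
        simp [this]
    have h4 : ∏ e' ∈ S, G.mult ((B.inc e').image ((B.inc e).piecewise a b)) =
        ∏ e' ∈ S, G.mult ((B.inc e').image b) :=
      Finset.prod_congr rfl fun e' he' => by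
        congr 1
        refine Finset.image_congr fun u hu => ?_
        by_cases hue : u ∈ B.inc e
        · obtain rfl := hS e' he' u hu hue
          simp [hue, hab]
        · simp [hue]
    rw [h1, h2, h3, h4]
    ring
  · rw [if_neg hab, if_neg (Ne.symm hab)]

/-- Every nonempty set of edges contains an edge attached to the others at one vertex at most. -/
def HasLeafEdges (B : IncHypergraph V E) : Prop :=
  ∀ S : Finset E, S.Nonempty → ∃ e ∈ S, ∃ v ∈ B.inc e, ∀ e' ∈ S, e' ≠ e →
    ∀ u ∈ B.inc e', u ∈ B.inc e → u = v

theorem weightedSum_congr {B : IncHypergraph V E} (hB : B.HasLeafEdges)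
    (G : IncHypergraph X F) (H : IncHypergraph Y F') [Nonempty X]
    (hGH : ∀ i, (univ : Finset X).val.map (G.color i) = (univ : Finset Y).val.map (H.color i))
    (n : ℕ) (S : Finset E) (hS : S.card = n) (i : ℕ) (w : V → X → ℚ) (w' : V → Y → ℚ)
    (hw : ∀ u a b, G.color i a = H.color i b → w u a = w' u b) :
    B.weightedSum G S w = B.weightedSum H S w' := by
  induction n generalizing S i w w' with
  | zero =>
    obtain ⟨σ, hσ⟩ := exists_equiv_of_map_univ_eq _ _ (hGH i)
    obtain rfl := Finset.card_eq_zero.1 hS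
    refine Fintype.sum_equiv (Equiv.arrowCongr (Equiv.refl V) σ) _ _ fun h => ?_
    simp only [Finset.prod_empty, mul_one]
    exact Finset.prod_congr rfl fun u _ => hw u _ _ (hσ _).symm
  | succ n ih =>
    obtain ⟨e, he, v, hv, hleaf⟩ := hB S (Finset.card_pos.1 (by omega))
    have hleaf' : ∀ e' ∈ S.erase e, ∀ u ∈ B.inc e', u ∈ B.inc e → u = v := fun e' he' =>
      hleaf e' (Finset.mem_of_mem_erase he') (Finset.ne_of_mem_erase he')
    have hG := weightedSum_insert B G (Finset.notMem_erase e S) hv hleaf' w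
    have hH := weightedSum_insert B H (Finset.notMem_erase e S) hv hleaf' w'
    obtain ⟨σ, -⟩ := exists_equiv_of_map_univ_eq _ _ (hGH 0)
    -- Each peeled edge costs one round of refinement; the old weights remain compatible because
    -- round `i + 1` refines round `i`.
    have hpeel := ih (S.erase e) (by rw [Finset.card_erase_of_mem he, hS]; rfl) (i + 1)
      (peelWeight G (B.inc e) v w) (peelWeight H (B.inc e) v w') (fun u a b hab => by
        have hab' := color_eq_of_color_succ_eq hab
        unfold peelWeight
        rw [edgeSum_congr G H (G.color i) (H.color i) (hGH i) hab' hab hv hw, hw u a b hab'])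
    rw [← hG, ← hH, Fintype.card_congr (Equiv.arrowCongr (Equiv.refl {u // u ≠ v}) σ.symm),
      Finset.insert_erase he] at hpeel
    refine mul_left_cancel₀ ?_ hpeel
    have : Nonempty Y := ⟨σ (Classical.arbitrary X)⟩
    exact Nat.cast_ne_zero.2 Fintype.card_ne_zero

theorem homCount_eq_weightedSum [Fintype E] (B : IncHypergraph V E) (G : IncHypergraph X F) :
    (B.homCount G : ℚ) = B.weightedSum G univ fun _ _ => 1 := by
  rw [homCount_eq_sum, weightedSum]
  simp

theorem HasLeafEdges.homCount_eq [Fintype E] [Nonempty V] {B : IncHypergraph V E} (hB : B.HasLeafEdges)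
    (G : IncHypergraph X F) (H : IncHypergraph Y F') (hGH : ¬ G.CRDistinguishes H) :
    B.homCount G = B.homCount H := by
  have hGH' : ∀ i, (univ : Finset X).val.map (G.color i) =
      (univ : Finset Y).val.map (H.color i) := by
    simpa [CRDistinguishes] using hGH
  have hcast : (B.homCount G : ℚ) = B.homCount H := by
    rw [homCount_eq_weightedSum, homCount_eq_weightedSum]
    obtain ⟨σ, -⟩ := exists_equiv_of_map_univ_eq _ _ (hGH' 0)
    rcases isEmpty_or_nonempty X with hX | hX
    · have : IsEmpty Y := σ.symm.isEmpty
      simp [weightedSum]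
    · exact weightedSum_congr hB G H hGH' _ univ rfl 0 _ _ fun _ _ _ _ => rfl
  exact_mod_cast hcast

end WeightedSum

/-! ### Leaf edges in Berge-acyclic hypergraphs -/

section LeafEdge

variable {V E : Type*}

/-- In a tree, a vertex has at most one neighbour which is closer to the root. -/
theorem eq_of_dist_add_one_eq {W : Type*} {T : SimpleGraph W} (hT : T.IsTree) {r a b z : W}
    (ha : T.Adj a z) (hb : T.Adj b z) (hda : T.dist r z = T.dist r a + 1)
    (hdb : T.dist r z = T.dist r b + 1) : a = b := by
  obtain ⟨p, hp⟩ := hT.connected.exists_walk_length_eq_dist r a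
  obtain ⟨q, hq⟩ := hT.connected.exists_walk_length_eq_dist r b
  have hp' : (p.concat ha).IsPath :=
    SimpleGraph.Walk.isPath_of_length_eq_dist _ (by rw [SimpleGraph.Walk.length_concat, hp, hda])
  have hq' : (q.concat hb).IsPath :=
    SimpleGraph.Walk.isPath_of_length_eq_dist _ (by rw [SimpleGraph.Walk.length_concat, hq, hdb])
  have h := congrArg (fun p => p.1.penultimate)
    ((hT.isAcyclic.subsingleton_path _ _).elim ⟨_, hp'⟩ ⟨_, hq'⟩)
  simpa using h

/-- Root the incidence tree and take an edge of `S` of maximal depth. Any other edge of `S` through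
one of its child vertices would be deeper, so contact is possible only at its parent vertex. -/
theorem hasLeafEdges_of_isBergeAcyclic {B : IncHypergraph V E} (hconn : B.IsConnected)
    (hB : B.IsBergeAcyclic) : B.HasLeafEdges := by
  intro S hS
  have hT : B.incidenceGraph.IsTree := ⟨hconn, hB⟩
  obtain ⟨r⟩ := hconn.nonempty
  let d := B.incidenceGraph.dist r
  obtain ⟨e, he, hmax⟩ := Finset.exists_max_image S (fun e => d (Sum.inr e)) hS
  have hd : ∀ {e u}, u ∈ B.inc e →
      d (Sum.inr e) = d (Sum.inl u) + 1 ∨ d (Sum.inl u) = d (Sum.inr e) + 1 := by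
    intro e u hu
    exact hT.dist_eq_dist_add_one_of_adj r ((incidenceGraph_adj_inr_inl B u e).2 hu)
  have hchild : ∀ u ∈ B.inc e, d (Sum.inl u) = d (Sum.inr e) + 1 → ∀ e' ∈ S, e' ≠ e →
      u ∉ B.inc e' := by
    intro u hu hdu e' he' hne hu'
    rcases hd hu' with h | h
    · have := hmax e' he'
      omega
    · exact hne (Sum.inr_injective (eq_of_dist_add_one_eq hT
        ((incidenceGraph_adj_inr_inl B u e').2 hu') ((incidenceGraph_adj_inr_inl B u e).2 hu)
        h hdu))
  by_cases hpar : ∃ v ∈ B.inc e, d (Sum.inr e) = d (Sum.inl v) + 1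
  · obtain ⟨v, hv, hdv⟩ := hpar
    refine ⟨e, he, v, hv, fun e' he' hne u hu' hu => ?_⟩
    rcases hd hu with h | h
    · exact Sum.inl_injective (eq_of_dist_add_one_eq hT
        ((incidenceGraph_adj_inl_inr B u e).2 hu) ((incidenceGraph_adj_inl_inr B v e).2 hv) h hdv)
    · exact absurd hu' (hchild u hu h e' he' hne)
  -- Without a parent, all vertices of `e` are children and `e` meets no other edge of `S`, so any
  -- `v` will do.
  · obtain ⟨v, hv⟩ := B.inc_nonempty e
    refine ⟨e, he, v, hv, fun e' he' hne u hu' hu => ?_⟩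
    exact absurd hu' (hchild u hu ((hd hu).resolve_left fun h => hpar ⟨u, hu, h⟩) e' he' hne)

end LeafEdge

/-! ### Gluing rooted trees along a new edge -/

section Glue

/-- The disjoint union of the hypergraphs `B i` with an additional edge through the `r i`. -/
def glue {ι : Type*} [Fintype ι] [Nonempty ι] {V E : ι → Type*}
    (B : ∀ i, IncHypergraph (V i) (E i)) (r : ∀ i, V i) :
    IncHypergraph (Σ i, V i) (Option (Σ i, E i)) where
  inc o := o.elim (univ.map ⟨fun i => ⟨i, r i⟩, fun _ _ h => congrArg Sigma.fst h⟩)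
    fun p => (B p.1).inc p.2 |>.map ⟨Sigma.mk p.1, sigma_mk_injective⟩
  inc_nonempty o := by
    cases o with
    | none => simp
    | some p => simpa using (B p.1).inc_nonempty p.2

section

variable {ι : Type*} [Fintype ι] [Nonempty ι] {V E : ι → Type*}
    (B : ∀ i, IncHypergraph (V i) (E i)) (r : ∀ i, V i)

theorem glue_inc_none : (glue B r).inc none =
    univ.map ⟨fun i => ⟨i, r i⟩, fun _ _ h => congrArg Sigma.fst h⟩ := rfl

theorem glue_inc_some (p : Σ i, E i) : (glue B r).inc (some p) =
    ((B p.1).inc p.2).map ⟨Sigma.mk p.1, sigma_mk_injective⟩ := rfl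

theorem glue_isConnected (hB : ∀ i, (B i).IsConnected) : (glue B r).IsConnected := by
  have hroot : ∀ i, (glue B r).incidenceGraph.Reachable (Sum.inr none) (Sum.inl ⟨i, r i⟩) :=
    fun i => SimpleGraph.Adj.reachable ((incidenceGraph_adj_inr_inl _ _ _).2
      (Finset.mem_map.2 ⟨i, Finset.mem_univ i, rfl⟩))
  have hcomp : ∀ i z, (glue B r).incidenceGraph.Reachable (Sum.inr none)
      (Sum.map (Sigma.mk i) (fun e => some ⟨i, e⟩) z) := by
    intro i z
    have h := ((hB i).preconnected (Sum.inl (r i)) z).map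
      (incidenceHom (B i) (glue B r) (Sigma.mk i) (fun e => some ⟨i, e⟩)
        (fun v e hve => by simpa [glue_inc_some] using hve))
    exact (hroot i).trans h
  refine SimpleGraph.Connected.mk (nonempty := ⟨Sum.inr none⟩) ?_
  have key : ∀ z, (glue B r).incidenceGraph.Reachable (Sum.inr none) z := by
    rintro (⟨i, v⟩ | (_ | ⟨i, e⟩))
    · exact hcomp i (Sum.inl v)
    · exact SimpleGraph.Reachable.refl _
    · exact hcomp i (Sum.inr e)
  exact fun z z' => (key z).symm.trans (key z')

theorem glue_card [∀ i, Fintype (V i)] [∀ i, Fintype (E i)]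
    (hB : ∀ i, (∑ e, ((B i).inc e).card) + 1 = Fintype.card (V i) + Fintype.card (E i)) :
    (∑ e, ((glue B r).inc e).card) + 1 =
      Fintype.card (Σ i, V i) + Fintype.card (Option (Σ i, E i)) := by
  rw [Fintype.sum_option, Fintype.card_option, Fintype.card_sigma, Fintype.card_sigma,
    Fintype.sum_sigma]
  simp only [glue_inc_none, glue_inc_some, Finset.card_map]
  have := Finset.sum_congr rfl fun i (_ : i ∈ (univ : Finset ι)) => hB i
  rw [Finset.sum_add_distrib, Finset.sum_add_distrib, Finset.sum_const, smul_eq_mul,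
    mul_one] at this
  omega

end

theorem card_edgeSet_incidenceGraph {V E : Type*} [Fintype E] (B : IncHypergraph V E) :
    Nat.card B.incidenceGraph.edgeSet = ∑ e, (B.inc e).card := by
  have h : Nat.card (Σ e, B.inc e) = ∑ e, (B.inc e).card := by
    simp [Nat.card_eq_fintype_card]
  rw [← h]
  refine (Nat.card_congr (Equiv.ofBijective (fun p : Σ e, B.inc e =>
    (⟨s(Sum.inl p.2.1, Sum.inr p.1), (incidenceGraph_adj_inl_inr _ _ _).2 p.2.2⟩ :
      B.incidenceGraph.edgeSet)) ⟨?_, ?_⟩)).symm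
  · rintro ⟨e, v, hv⟩ ⟨e', v', hv'⟩ h
    have h := congrArg Subtype.val h
    simp only [Sym2.eq_iff, Sum.inl.injEq, Sum.inr.injEq, reduceCtorEq,
      and_self, or_false] at h
    obtain ⟨rfl, rfl⟩ := h
    rfl
  · rintro ⟨z, hz⟩
    induction z using Sym2.ind with
    | _ a b =>
      rcases (show B.incidenceGraph.Adj a b from hz) with
        ⟨v, e, h, rfl, rfl⟩ | ⟨v, e, h, rfl, rfl⟩
      · exact ⟨⟨e, v, h⟩, rfl⟩
      · exact ⟨⟨e, v, h⟩, Subtype.ext Sym2.eq_swap⟩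

/-- A connected graph with one edge fewer than vertices is a tree. This numerical criterion is easy
to carry through gluing. -/
theorem IsConnected.isBergeAcyclic_of_card {V E : Type*} [Fintype V] [Fintype E]
    {B : IncHypergraph V E} (hB : B.IsConnected)
    (hcard : (∑ e, (B.inc e).card) + 1 = Fintype.card V + Fintype.card E) :
    B.IsBergeAcyclic := by
  refine (SimpleGraph.isTree_iff_connected_and_card.2 ⟨hB, ?_⟩).isAcyclic
  rw [card_edgeSet_incidenceGraph, hcard, Nat.card_eq_fintype_card, Fintype.card_sum]

end Glue

/-! ### The algebra spanned by tree functions -/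

section TreeFunction

variable {X F : Type*} [Fintype X] [Fintype F]

/-- The functions counting the homomorphisms from a rooted tree hypergraph by the image of the
root. -/
inductive TreeFunction (K : IncHypergraph X F) : (X → ℚ) → Prop
  | one : TreeFunction K 1
  | edge (k : ℕ) (φ : Fin (k + 1) → X → ℚ) (hφ : ∀ i, TreeFunction K (φ i)) :
      TreeFunction K (K.edgeSum univ 0 φ)

/-- The number of homomorphisms with `r ↦ x`. -/
noncomputable def rootedHomSum {V E : Type*} [Fintype V] [Fintype E] (B : IncHypergraph V E)
    (K : IncHypergraph X F) (r : V) (x : X) : ℚ :=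
  ∑ h : V → X, if h r = x then ∏ e, K.mult ((B.inc e).image h) else 0

theorem rootedHomSum_glue {k : ℕ} {V E : Fin (k + 1) → Type*} [∀ i, Fintype (V i)]
    [∀ i, Fintype (E i)] (B : ∀ i, IncHypergraph (V i) (E i)) (r : ∀ i, V i)
    (K : IncHypergraph X F) (x : X) :
    (glue B r).rootedHomSum K ⟨0, r 0⟩ x =
      K.edgeSum univ 0 (fun i => (B i).rootedHomSum K (r i)) x := by
  have hR : K.edgeSum univ 0 (fun i => (B i).rootedHomSum K (r i)) x =
      ∑ h : ∀ i, V i → X, if h 0 (r 0) = x then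
        (∏ i, ∏ e, K.mult (((B i).inc e).image (h i))) *
          K.mult (univ.image fun i => h i (r i)) else 0 := by
    -- Expanding the product of rooted sums gives a sum over families of maps, in which `t` must
    -- record the images of the roots.
    have h1 : ∀ t : Fin (k + 1) → X, (if t 0 = x then
        (∏ i, (B i).rootedHomSum K (r i) (t i)) * K.mult (univ.image t) else 0) =
        ∑ h : ∀ i, V i → X, if (fun i => h i (r i)) = t then
          (if h 0 (r 0) = x then (∏ i, ∏ e, K.mult (((B i).inc e).image (h i))) *
            K.mult (univ.image fun i => h i (r i)) else 0) else 0 := by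
      intro t
      unfold rootedHomSum
      rw [Finset.prod_univ_sum, Fintype.piFinset_univ]
      by_cases ht : t 0 = x
      · rw [if_pos ht, Finset.sum_mul]
        refine Finset.sum_congr rfl fun h _ => ?_
        by_cases hht : (fun i => h i (r i)) = t
        · subst hht
          simp [ht]
        · obtain ⟨i, hi⟩ := Function.ne_iff.1 hht
          rw [if_neg hht, Finset.prod_eq_zero (Finset.mem_univ i) (if_neg hi), zero_mul]
      · rw [if_neg ht, eq_comm]
        refine Finset.sum_eq_zero fun h _ => ?_
        by_cases hht : (fun i => h i (r i)) = t
        · rw [if_pos hht, if_neg]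
          rw [← hht] at ht
          exact ht
        · rw [if_neg hht]
    unfold edgeSum
    rw [Finset.sum_congr rfl fun t _ => h1 t, Finset.sum_comm]
    refine Finset.sum_congr rfl fun h _ => ?_
    simp
  rw [hR]
  refine @Fintype.sum_equiv _ _ _ (_) (_) _ (Equiv.piCurry fun _ _ => X) _ _ fun h => ?_
  have h0 : ∀ i v, (Equiv.piCurry (fun _ _ => X) h) i v = h ⟨i, v⟩ := fun _ _ => rfl
  rw [h0, Fintype.prod_option, Fintype.prod_sigma, mul_comm]
  refine if_congr Iff.rfl ?_ rfl
  congr 1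
  · refine Finset.prod_congr rfl fun i _ => Finset.prod_congr rfl fun e _ => ?_
    rw [glue_inc_some, Finset.map_eq_image, Finset.image_image]
    rfl
  · rw [glue_inc_none, Finset.map_eq_image, Finset.image_image]
    rfl

theorem TreeFunction.exists_rootedHomSum {K : IncHypergraph X F} {φ : X → ℚ}
    (hφ : K.TreeFunction φ) :
    ∃ (V E : Type) (_ : Fintype V) (_ : Fintype E) (B : IncHypergraph V E) (r : V),
      B.IsConnected ∧ (∑ e, (B.inc e).card) + 1 = Fintype.card V + Fintype.card E ∧
        B.rootedHomSum K r = φ := by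
  induction hφ with
  | one =>
    refine ⟨Unit, Empty, inferInstance, inferInstance, ⟨Empty.elim, fun e => e.elim⟩, (), ?_,
      by simp, ?_⟩
    · have : Subsingleton (Unit ⊕ Empty) := by
        constructor
        rintro (_ | e) (_ | e') <;> first | rfl | contradiction
      exact SimpleGraph.Connected.mk (nonempty := ⟨Sum.inl ()⟩) .of_subsingleton
    · ext x
      exact (@Fintype.sum_equiv _ _ _ (_) _ _ (Equiv.funUnique Unit X) _
        (fun y => if y = x then (1 : ℚ) else 0) (fun h => by simp)).trans (by simp)
  | edge k φ _ ih =>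
    choose V E iV iE B r hconn hcard hsum using ih
    refine ⟨Σ i, V i, Option (Σ i, E i), inferInstance, inferInstance, glue B r, ⟨0, r 0⟩,
      glue_isConnected B r hconn, glue_card B r hcard, ?_⟩
    ext x
    rw [rootedHomSum_glue]
    simp only [hsum]

/-- Multiplication corresponds to identifying roots: since `h 0 = x` in every nonzero summand, `ψ`
can be absorbed into the factor at position `0`. -/
theorem TreeFunction.mul {K : IncHypergraph X F} {φ ψ : X → ℚ} (hφ : K.TreeFunction φ)
    (hψ : K.TreeFunction ψ) : K.TreeFunction (φ * ψ) := by
  induction hφ with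
  | one => rwa [one_mul]
  | edge k φ hφ ih =>
    have h : K.edgeSum univ 0 φ * ψ = K.edgeSum univ 0 (Function.update φ 0 (φ 0 * ψ)) := by
      ext x
      rw [Pi.mul_apply, edgeSum, edgeSum, Finset.sum_mul]
      refine Finset.sum_congr rfl fun h _ => ?_
      by_cases hx : h 0 = x
      · rw [if_pos hx, if_pos hx, Fin.prod_univ_succ, Fin.prod_univ_succ]
        simp [hx]
        ring
      · rw [if_neg hx, if_neg hx, zero_mul]
    rw [h]
    refine .edge k _ fun i => ?_
    by_cases hi : i = 0
    · subst hi
      rw [Function.update_self]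
      exact ih 0
    · rw [Function.update_of_ne hi]
      exact hφ i

/-- The class of `x` with respect to indistinguishability by tree functions. -/
def treeClass (K : IncHypergraph X F) (x : X) : Set X :=
  {y | ∀ φ, K.TreeFunction φ → φ x = φ y}

theorem treeClass_eq_iff (K : IncHypergraph X F) {x y : X} :
    K.treeClass x = K.treeClass y ↔ ∀ φ, K.TreeFunction φ → φ x = φ y := by
  constructor
  · intro h
    have : y ∈ K.treeClass y := fun φ _ => rfl
    rw [← h] at this
    exact this
  · intro h
    ext z
    exact forall₂_congr fun φ hφ => by rw [h φ hφ]

theorem span_treeFunction_apply_eq {K : IncHypergraph X F} {x y : X}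
    (h : K.treeClass x = K.treeClass y) {φ : X → ℚ}
    (hφ : φ ∈ Submodule.span ℚ {φ | K.TreeFunction φ}) : φ x = φ y := by
  induction hφ using Submodule.span_induction with
  | mem φ hφ => exact (K.treeClass_eq_iff.1 h) φ hφ
  | zero => rfl
  | add φ ψ _ _ h1 h2 => rw [Pi.add_apply, Pi.add_apply, h1, h2]
  | smul a φ _ h1 => rw [Pi.smul_apply, Pi.smul_apply, h1]

theorem adjoin_treeFunction (K : IncHypergraph X F) :
    Subalgebra.toSubmodule (Algebra.adjoin ℚ {φ | K.TreeFunction φ}) =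
      Submodule.span ℚ {φ | K.TreeFunction φ} := by
  rw [Algebra.adjoin_eq_span]
  congr 1
  let M : Submonoid (X → ℚ) :=
    { carrier := {φ | K.TreeFunction φ}
      one_mem' := .one
      mul_mem' := .mul }
  exact congrArg SetLike.coe (Submonoid.closure_eq M)

theorem indicator_mem_span_treeFunction (K : IncHypergraph X F) (S : Set X) :
    (fun z => if K.treeClass z = S then (1 : ℚ) else 0) ∈
      Submodule.span ℚ {φ | K.TreeFunction φ} := by
  by_cases hS : ∃ x, K.treeClass x = S
  · obtain ⟨x, rfl⟩ := hS
    have hsep : ∀ y, ∃ φ, K.TreeFunction φ ∧ (K.treeClass y ≠ K.treeClass x → φ x ≠ φ y) := by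
      intro y
      by_cases hy : K.treeClass y = K.treeClass x
      · exact ⟨1, .one, fun h => absurd hy h⟩
      · have := mt K.treeClass_eq_iff.2 (Ne.symm hy)
        push Not at this
        obtain ⟨φ, hφ, hne⟩ := this
        exact ⟨φ, hφ, fun _ => hne⟩
    choose φ hφ hne using hsep
    -- Lagrange interpolation: the factor for `y` is `1` at `x` and vanishes at `y`.
    let p : X → ℚ := ∏ y with K.treeClass y ≠ K.treeClass x,
      ((φ y x - φ y y)⁻¹ • (φ y - algebraMap ℚ (X → ℚ) (φ y y)))
    have hp : p ∈ Submodule.span ℚ {φ | K.TreeFunction φ} := by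
      rw [← adjoin_treeFunction, Subalgebra.mem_toSubmodule]
      refine Subalgebra.prod_mem _ fun y _ => Subalgebra.smul_mem _ (Subalgebra.sub_mem _ ?_ ?_) _
      · exact Algebra.subset_adjoin (hφ y)
      · exact Subalgebra.algebraMap_mem _ _
    have hpz : ∀ z, p z = ∏ y with K.treeClass y ≠ K.treeClass x,
        ((φ y x - φ y y)⁻¹ * (φ y z - φ y y)) := fun z => by
      simp only [p, Finset.prod_apply]
      rfl
    convert hp using 1
    ext z
    by_cases hz : K.treeClass z = K.treeClass x
    · rw [if_pos hz, span_treeFunction_apply_eq hz hp, hpz, eq_comm]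
      refine Finset.prod_eq_one fun y hy => ?_
      have := sub_ne_zero.2 (hne y (Finset.mem_filter.1 hy).2)
      exact inv_mul_cancel₀ this
    · rw [if_neg hz, hpz, eq_comm]
      exact Finset.prod_eq_zero (i := z) (by simpa using hz) (by simp)
  · push Not at hS
    convert Submodule.zero_mem _
    simp [hS]

theorem edgeSum_mem_span (K : IncHypergraph X F) {V : Type*} [Fintype V] (v : V)
    {A : Set (X → ℚ)}
    (hA : ∀ φ : V → X → ℚ, (∀ i, φ i ∈ A) → K.edgeSum univ v φ ∈ Submodule.span ℚ A)
    (φ : V → X → ℚ) (hφ : ∀ i, φ i ∈ Submodule.span ℚ A) :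
    K.edgeSum univ v φ ∈ Submodule.span ℚ A := by
  -- By multilinearity the factors are handled one position at a time; `s` holds the positions where
  -- only membership in the span is known.
  suffices key : ∀ (s : Finset V) (φ : V → X → ℚ), (∀ i ∈ s, φ i ∈ Submodule.span ℚ A) →
      (∀ i ∉ s, φ i ∈ A) → K.edgeSum univ v φ ∈ Submodule.span ℚ A from
    key univ φ (fun i _ => hφ i) (fun i hi => absurd (Finset.mem_univ i) hi)
  intro s
  induction s using Finset.induction_on with
  | empty => exact fun φ _ h => hA φ fun i => h i (by simp)
  | insert i s hi ih =>
    intro φ h1 h2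
    have hlin : ∀ ψ, K.edgeSum univ v (Function.update φ i ψ) = fun x => ∑ h : V → X,
        if h v = x then ψ (h i) * ((∏ j ∈ univ.erase i, φ j (h j)) * K.mult (univ.image h))
          else 0 := by
      intro ψ
      ext x
      refine Finset.sum_congr rfl fun h _ => if_congr Iff.rfl ?_ rfl
      rw [← Finset.mul_prod_erase univ _ (Finset.mem_univ i), Function.update_self, mul_assoc]
      congr 2
      refine Finset.prod_congr rfl fun j hj => ?_
      rw [Function.update_of_ne (Finset.ne_of_mem_erase hj)]
    rw [← Function.update_eq_self i φ]
    have hi' := h1 i (Finset.mem_insert_self i s)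
    generalize φ i = ψ at hi' ⊢
    induction hi' using Submodule.span_induction with
    | mem ψ hψ =>
      refine ih _ (fun j hj => ?_) (fun j hj => ?_)
      · have : j ≠ i := fun h => hi (h ▸ hj)
        rw [Function.update_of_ne this]
        exact h1 j (Finset.mem_insert_of_mem hj)
      · by_cases hji : j = i
        · subst hji
          rwa [Function.update_self]
        · rw [Function.update_of_ne hji]
          exact h2 j (by simp [hji, hj])
    | zero =>
      rw [hlin]
      convert Submodule.zero_mem _
      simp
    | add ψ ψ' _ _ h3 h4 =>
      convert Submodule.add_mem _ h3 h4 using 1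
      rw [hlin, hlin, hlin]
      ext x
      rw [Pi.add_apply, ← Finset.sum_add_distrib]
      refine Finset.sum_congr rfl fun h _ => ?_
      by_cases hx : h v = x
      · simp only [if_pos hx, Pi.add_apply]
        ring
      · simp [hx]
    | smul a ψ _ h3 =>
      convert Submodule.smul_mem _ a h3 using 1
      rw [hlin, hlin]
      ext x
      rw [Pi.smul_apply, Finset.smul_sum]
      refine Finset.sum_congr rfl fun h _ => ?_
      by_cases hx : h v = x
      · simp only [if_pos hx, Pi.smul_apply, smul_eq_mul]
        ring
      · simp [hx]

theorem edgeSum_mem_span_treeFunction (K : IncHypergraph X F) {k : ℕ}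
    (φ : Fin (k + 1) → X → ℚ) (hφ : ∀ i, φ i ∈ Submodule.span ℚ {φ | K.TreeFunction φ}) :
    K.edgeSum univ 0 φ ∈ Submodule.span ℚ {φ | K.TreeFunction φ} :=
  K.edgeSum_mem_span 0 (fun φ h => Submodule.subset_span (.edge k φ h)) φ hφ

end TreeFunction

/-! ### Tree classes form an equitable partition -/

section Stability

variable {X F C : Type*} [Fintype F]

/-- The number of edges at `x` whose vertices have the colours `M`. -/
noncomputable def edgeCount (K : IncHypergraph X F) (c : X → C) (x : X) (M : Multiset C) : ℕ :=
  (univ.filter fun g => x ∈ K.inc g ∧ (K.inc g).val.map c = M).card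

/-- An equitable colouring is stable: if round `i` factors through `c`, then so does round `i + 1`,
via the edge counts. -/
theorem color_eq_of_edgeCount_eq (K : IncHypergraph X F) (c : X → C)
    (hc : ∀ (M : Multiset C) (x y : X), c x = c y → K.edgeCount c x M = K.edgeCount c y M)
    (i : ℕ) (x y : X) (hxy : c x = c y) : K.color i x = K.color i y := by
  induction i generalizing x y with
  | zero => rfl
  | succ i ih =>
    have hfac : (K.color i).FactorsThrough c := fun a b hab => ih a b hab
    let γ : C → Color i := Function.extend c (K.color i) fun _ => K.color i x
    have hγ : γ ∘ c = K.color i := funext fun a => hfac.extend_apply (fun _ => K.color i x) a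
    have hcol : ∀ z, K.color (i + 1) z =
        ((univ.filter fun g => z ∈ K.inc g).val.map fun g => (K.inc g).val.map c).map
          (Multiset.map γ) := by
      intro z
      rw [Multiset.map_map]
      refine Multiset.map_congr rfl fun g _ => ?_
      rw [Function.comp_apply, Multiset.map_map, hγ]
    rw [hcol, hcol]
    congr 1
    ext M
    have hcount : ∀ z, Multiset.count M
        ((univ.filter fun g => z ∈ K.inc g).val.map fun g => (K.inc g).val.map c) =
        K.edgeCount c z M := by
      intro z
      rw [Multiset.count_map, edgeCount, ← Finset.filter_filter]
      simp only [eq_comm (a := M)]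
      rfl
    rw [hcount, hcount, hc M x y hxy]

variable [Fintype X]

/-- The indicators of the colour classes prescribed by `κ`. -/
noncomputable def classWeight {V : Type*} (c : X → C) (κ : V → C) (u : V) (z : X) : ℚ :=
  if c z = κ u then 1 else 0

theorem coverSum_classWeight {V : Type*} [Fintype V] (c : X → C) (κ : V → C) (A : Finset X)
    (v : V) (x : X) :
    coverSum A univ v (classWeight c κ) x =
      (univ.filter fun h : V → X => h v = x ∧ univ.image h = A ∧ ∀ u, c (h u) = κ u).card := by
  rw [← Finset.sum_boole, coverSum]
  refine Finset.sum_congr rfl fun h _ => ?_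
  by_cases hh : ∀ u, c (h u) = κ u
  · have : ∏ u, classWeight c κ u (h u) = 1 := Finset.prod_eq_one fun u _ => if_pos (hh u)
    rw [this]
    exact if_congr (by simp [hh]) rfl rfl
  · obtain ⟨u, hu⟩ := not_forall.1 hh
    have : ∏ u, classWeight c κ u (h u) = 0 :=
      Finset.prod_eq_zero (Finset.mem_univ u) (if_neg hu)
    rw [this, ite_self, if_neg fun h => hh h.2.2]

/-- A nonzero sum provides a colour-respecting surjection from `V` onto `A`, which is a bijection
when the sizes agree. -/
theorem card_le_of_coverSum_classWeight_ne_zero {V : Type*} [Fintype V] {c : X → C} {κ : V → C}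
    {A : Finset X} {v : V} {x : X} (h : coverSum A univ v (classWeight c κ) x ≠ 0) :
    A.card ≤ Fintype.card V ∧
      (A.card = Fintype.card V → A.val.map c = (univ : Finset V).val.map κ) := by
  rw [coverSum_classWeight, Nat.cast_ne_zero, Finset.card_ne_zero] at h
  obtain ⟨f, hf⟩ := h
  obtain ⟨-, rfl, hκ⟩ := (Finset.mem_filter.1 hf).2
  refine ⟨Finset.card_image_le, fun hcard => ?_⟩
  rw [Finset.image_val_of_injOn (Finset.card_image_iff.1 hcard), Multiset.map_map]
  exact Multiset.map_congr rfl fun u _ => hκ u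

theorem coverSum_classWeight_ne_zero {V : Type*} [Fintype V] {c : X → C} {κ : V → C}
    {A : Finset X} {v : V} {x : X} (hx : x ∈ A) (hxv : κ v = c x)
    (h : (univ : Finset V).val.map κ = A.val.map c) :
    coverSum A univ v (classWeight c κ) x ≠ 0 := by
  rw [coverSum_classWeight, Nat.cast_ne_zero, Finset.card_ne_zero]
  have hA : A.val.map c = (univ : Finset A).val.map fun a : A => c a.1 :=
    (Multiset.attach_map_val' A.val c).symm
  -- The marked sets are the whole types here; only the marked points matter, forcing `v ↦ x`.
  obtain ⟨σ, hσ, hv, -⟩ := exists_equiv_image κ (fun a : A => c a.1) (h.trans hA) (h.trans hA)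
    (Finset.mem_univ v) (Finset.mem_univ ⟨x, hx⟩) hxv
  refine ⟨fun u => σ u, Finset.mem_filter.2 ⟨Finset.mem_univ _, congrArg Subtype.val hv, ?_, hσ⟩⟩
  ext z
  rw [Finset.mem_image]
  constructor
  · rintro ⟨u, -, rfl⟩
    exact (σ u).2
  · exact fun hz => ⟨σ.symm ⟨z, hz⟩, Finset.mem_univ _, by simp⟩

theorem exists_fin_enumeration (c₀ : C) (M : Multiset C) :
    ∃ κ : Fin (M.card + 1) → C, κ 0 = c₀ ∧
      (univ : Finset (Fin (M.card + 1))).val.map κ = c₀ ::ₘ M := by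
  induction M using Quotient.inductionOn with
  | _ l =>
    refine ⟨Fin.cons c₀ l.get, rfl, ?_⟩
    rw [Fin.univ_val_map]
    change ((List.ofFn (Fin.cons c₀ l.get : Fin (l.length + 1) → C) : List C) : Multiset C) = _
    rw [List.ofFn_cons, List.ofFn_get]
    rfl

/-- For `κ` enumerating `M`, the edge sum is a combination of edge counts over colour multisets `N`.
Its coefficient at `M` is nonzero, and those at other `N` vanish unless `N` is smaller than `M`.
Induction on the size of `M` solves this triangular system. -/
theorem edgeCount_eq_of_edgeSum_eq (K : IncHypergraph X F) (c : X → C)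
    (hc : ∀ (k : ℕ) (κ : Fin (k + 1) → C) (x y : X), c x = c y →
      K.edgeSum univ 0 (classWeight c κ) x = K.edgeSum univ 0 (classWeight c κ) y)
    (n : ℕ) (M : Multiset C) (hM : M.card = n) (x y : X) (hxy : c x = c y) :
    K.edgeCount c x M = K.edgeCount c y M := by
  induction n using Nat.strong_induction_on generalizing M with
  | _ n ih =>
  by_cases hex : ∃ z g, c z = c x ∧ z ∈ K.inc g ∧ (K.inc g).val.map c = M
  swap
  · have h0 : ∀ z, c z = c x → K.edgeCount c z M = 0 := fun z hz =>
      Finset.card_eq_zero.2 (Finset.filter_eq_empty_iff.2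
        fun g _ h => hex ⟨z, g, hz, h.1, h.2⟩)
    rw [h0 x rfl, h0 y hxy.symm]
  obtain ⟨z₀, g₀, hz₀, hzg₀, hMg₀⟩ := hex
  have hmem : c x ∈ M := by
    rw [← hz₀, ← hMg₀]
    exact Multiset.mem_map_of_mem c hzg₀
  obtain ⟨M', rfl⟩ := Multiset.exists_cons_of_mem hmem
  obtain ⟨κ, hκ₀, hκ⟩ := exists_fin_enumeration (c x) M'
  rw [Multiset.card_cons] at hM
  let T : X → F → ℚ := fun z g => coverSum (K.inc g) univ 0 (classWeight c κ) z
  have hT : ∀ z g z' g', c z = c z' → z ∈ K.inc g → z' ∈ K.inc g' →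
      (K.inc g).val.map c = (K.inc g').val.map c → T z g = T z' g' :=
    fun z g z' g' hzz hz hz' hgg => coverSum_congr c c rfl hgg hz hz' hzz _ _
      fun u a b hab => by rw [classWeight, classWeight, hab]
  -- The common value of `T` at edges of colour `N` through a vertex of the class of `x`; the value
  -- `0` is used where no such edge exists.
  let τ : Multiset C → ℚ := fun N =>
    if h : ∃ p : X × F, c p.1 = c x ∧ p.1 ∈ K.inc p.2 ∧ (K.inc p.2).val.map c = N then
      T h.choose.1 h.choose.2 else 0
  have hτ : ∀ z g, c z = c x → z ∈ K.inc g → T z g = τ ((K.inc g).val.map c) := by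
    intro z g hz hzg
    have h : ∃ p : X × F, c p.1 = c x ∧ p.1 ∈ K.inc p.2 ∧
        (K.inc p.2).val.map c = (K.inc g).val.map c := ⟨(z, g), hz, hzg, rfl⟩
    simp only [τ, dif_pos h]
    obtain ⟨h1, h2, h3⟩ := h.choose_spec
    exact hT _ _ _ _ (hz.trans h1.symm) hzg h2 h3.symm
  have hτM : τ (c x ::ₘ M') ≠ 0 := by
    rw [← hMg₀, ← hτ z₀ g₀ hz₀ hzg₀]
    exact coverSum_classWeight_ne_zero hzg₀ (hκ₀.trans hz₀.symm) (hκ.trans hMg₀.symm)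
  have hτN : ∀ N, τ N ≠ 0 → N ≠ c x ::ₘ M' → N.card < n := by
    intro N hN hne
    by_cases h : ∃ p : X × F, c p.1 = c x ∧ p.1 ∈ K.inc p.2 ∧ (K.inc p.2).val.map c = N
    · obtain ⟨⟨z, g⟩, hz, hzg, rfl⟩ := h
      rw [← hτ z g hz hzg] at hN
      obtain ⟨h1, h2⟩ := card_le_of_coverSum_classWeight_ne_zero hN
      rw [Fintype.card_fin] at h1 h2
      dsimp only at h1 h2 hne ⊢
      rw [Multiset.card_map, Finset.card_val]
      rcases h1.lt_or_eq with h | h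
      · omega
      · exact absurd ((h2 h).trans hκ) hne
    · exact absurd (dif_neg h) hN
  let P : Finset (Multiset C) := univ.image fun g => (K.inc g).val.map c
  have hsum : ∀ z, c z = c x → K.edgeSum univ 0 (classWeight c κ) z =
      ∑ N ∈ P, (K.edgeCount c z N : ℚ) * τ N := by
    intro z hz
    have hfiber := Finset.sum_fiberwise_of_maps_to (s := univ.filter fun g => z ∈ K.inc g)
      (t := P) (g := fun g => (K.inc g).val.map c)
      (fun g _ => Finset.mem_image_of_mem _ (Finset.mem_univ g)) (T z)
    have hedge := edgeSum_eq_sum_coverSum K (Finset.mem_univ (0 : Fin (M'.card + 1)))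
      (classWeight c κ) z
    rw [hedge]
    refine hfiber.symm.trans (Finset.sum_congr rfl fun N _ => ?_)
    rw [Finset.filter_filter, edgeCount, ← nsmul_eq_mul, ← Finset.sum_const]
    refine Finset.sum_congr rfl fun g hg => ?_
    obtain ⟨hzg, rfl⟩ := (Finset.mem_filter.1 hg).2
    exact hτ z g hz hzg
  have hMP : c x ::ₘ M' ∈ P := hMg₀ ▸ Finset.mem_image_of_mem _ (Finset.mem_univ g₀)
  have heq := hc _ κ x y hxy
  rw [hsum x rfl, hsum y hxy.symm, ← Finset.add_sum_erase P _ hMP,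
    ← Finset.add_sum_erase P _ hMP] at heq
  have hrest : ∑ N ∈ P.erase (c x ::ₘ M'), (K.edgeCount c x N : ℚ) * τ N =
      ∑ N ∈ P.erase (c x ::ₘ M'), (K.edgeCount c y N : ℚ) * τ N := by
    refine Finset.sum_congr rfl fun N hN => ?_
    by_cases h0 : τ N = 0
    · rw [h0, mul_zero, mul_zero]
    · rw [ih _ (hτN N h0 (Finset.ne_of_mem_erase hN)) N rfl]
  rw [hrest] at heq
  exact_mod_cast mul_right_cancel₀ hτM (add_right_cancel heq)

theorem color_eq_of_treeClass_eq (K : IncHypergraph X F) (i : ℕ) {x y : X}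
    (hxy : K.treeClass x = K.treeClass y) : K.color i x = K.color i y :=
  K.color_eq_of_edgeCount_eq K.treeClass (fun M x y h =>
    K.edgeCount_eq_of_edgeSum_eq K.treeClass (fun _ κ _ _ h =>
      span_treeFunction_apply_eq h (K.edgeSum_mem_span_treeFunction _ fun u =>
        K.indicator_mem_span_treeFunction (κ u))) _ M rfl x y h) i x y hxy

end Stability

/-! ### Disjoint unions and the passage back to `G` and `H` -/

section Component

/-- `G` is embedded into `K` as a union of connected components. -/
structure IsComponentEmbedding {X F X' F' : Type*} (G : IncHypergraph X F)
    (K : IncHypergraph X' F') (a : X ↪ X') (b : F ↪ F') : Prop where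
  inc_apply : ∀ e, K.inc (b e) = (G.inc e).map a
  exists_of_mem : ∀ e' v, a v ∈ K.inc e' → ∃ e, b e = e'

variable {X F X' F' : Type*}
  {G : IncHypergraph X F} {K : IncHypergraph X' F'} {a : X ↪ X'} {b : F ↪ F'}

theorem IsComponentEmbedding.mem_range_of_connected (h : G.IsComponentEmbedding K a b)
    {V E : Type*} {B : IncHypergraph V E} (hB : B.IsConnected) {f : V → X'}
    (hf : ∀ e, ∃ g, K.inc g = (B.inc e).image f) {r : V} (hr : f r ∈ Set.range a) (v : V) :
    f v ∈ Set.range a := by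
  have hstep : ∀ e u v, u ∈ B.inc e → v ∈ B.inc e → f u ∈ Set.range a → f v ∈ Set.range a := by
    rintro e u v hu hv ⟨x, hx⟩
    obtain ⟨g, hg⟩ := hf e
    obtain ⟨e', rfl⟩ := h.exists_of_mem g x (by
      rw [hg, hx]
      exact Finset.mem_image_of_mem f hu)
    have hfv : f v ∈ (B.inc e).image f := Finset.mem_image_of_mem f hv
    rw [← hg, h.inc_apply, Finset.mem_map] at hfv
    obtain ⟨y, -, hy⟩ := hfv
    exact ⟨y, hy⟩
  -- This property is passed on along every adjacency of the incidence graph, so it spreads from `r`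
  -- along walks.
  let q : V ⊕ E → Prop := Sum.elim (fun v => f v ∈ Set.range a)
    fun e => ∀ u ∈ B.inc e, f u ∈ Set.range a
  have hq : ∀ s t, B.incidenceGraph.Adj s t → q s → q t := by
    rintro _ _ (⟨u, e, hue, rfl, rfl⟩ | ⟨u, e, hue, rfl, rfl⟩) hqs
    · exact fun w hw => hstep e u w hue hw hqs
    · exact hqs u hue
  obtain ⟨p⟩ := hB.preconnected (Sum.inl r) (Sum.inl v)
  have hwalk : ∀ s t, B.incidenceGraph.Walk s t → q s → q t := by
    intro s t p
    induction p with
    | nil => exact id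
    | cons hadj _ ih => exact fun hs => ih (hq _ _ hadj hs)
  exact hwalk _ _ p hr

/-- The disjoint union of two hypergraphs. -/
def disjointUnion (G : IncHypergraph X F) (H : IncHypergraph X' F') :
    IncHypergraph (X ⊕ X') (F ⊕ F') where
  inc := Sum.elim (fun e => (G.inc e).map .inl) (fun e => (H.inc e).map .inr)
  inc_nonempty := by
    rintro (e | e)
    · exact (G.inc_nonempty e).map
    · exact (H.inc_nonempty e).map

theorem disjointUnion_inl (G : IncHypergraph X F) (H : IncHypergraph X' F') :
    G.IsComponentEmbedding (G.disjointUnion H) .inl .inl where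
  inc_apply _ := rfl
  exists_of_mem := by
    rintro (e | e) v hv
    · exact ⟨e, rfl⟩
    · obtain ⟨w, -, hw⟩ := Finset.mem_map.1 hv
      cases hw

theorem disjointUnion_inr (G : IncHypergraph X F) (H : IncHypergraph X' F') :
    H.IsComponentEmbedding (G.disjointUnion H) .inr .inr where
  inc_apply _ := rfl
  exists_of_mem := by
    rintro (e | e) v hv
    · obtain ⟨w, -, hw⟩ := Finset.mem_map.1 hv
      cases hw
    · exact ⟨e, rfl⟩

section

variable [Fintype F] [Fintype F']

theorem IsComponentEmbedding.color_apply (h : G.IsComponentEmbedding K a b) (i : ℕ) (x : X) :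
    K.color i (a x) = G.color i x := by
  induction i generalizing x with
  | zero => rfl
  | succ i ih =>
    have hfilter : (univ.filter fun e' => a x ∈ K.inc e') =
        (univ.filter fun e => x ∈ G.inc e).map b := by
      ext e'
      simp only [Finset.mem_filter, Finset.mem_univ, true_and, Finset.mem_map]
      constructor
      · intro hx
        obtain ⟨e, rfl⟩ := h.exists_of_mem e' x hx
        rw [h.inc_apply, Finset.mem_map' a] at hx
        exact ⟨e, hx, rfl⟩
      · rintro ⟨e, hx, rfl⟩
        rwa [h.inc_apply, Finset.mem_map' a]
    change Multiset.map _ _ = Multiset.map _ _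
    rw [hfilter, Finset.map_val, Multiset.map_map]
    refine Multiset.map_congr rfl fun e _ => ?_
    rw [Function.comp_apply, h.inc_apply, Finset.map_val, Multiset.map_map]
    exact Multiset.map_congr rfl fun y _ => ih y

theorem IsComponentEmbedding.mult_map (h : G.IsComponentEmbedding K a b) (A : Finset X) :
    K.mult (A.map a) = G.mult A := by
  refine (Finset.sum_of_injOn b b.injective.injOn (fun _ _ => Finset.mem_univ _)
    (fun e' _ he' => if_neg fun heq => he' ?_) fun e _ => if_congr ?_ rfl rfl).symm
  · obtain ⟨z, hz⟩ := K.inc_nonempty e'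
    rw [heq, Finset.mem_map] at hz
    obtain ⟨y, hy, rfl⟩ := hz
    obtain ⟨e, rfl⟩ := h.exists_of_mem e' y (heq ▸ Finset.mem_map_of_mem a hy)
    exact ⟨e, Finset.mem_coe.2 (Finset.mem_univ e), rfl⟩
  · rw [h.inc_apply, Finset.map_inj]

end

variable [Fintype X] [Fintype F] [Fintype X'] [Fintype F']

/-- As `B` is connected, a homomorphism to `K` whose root lands in `G` lies entirely in `G`. -/
theorem IsComponentEmbedding.sum_rootedHomSum (h : G.IsComponentEmbedding K a b)
    {V E : Type*} [Fintype V] [Fintype E] {B : IncHypergraph V E} (hB : B.IsConnected) (r : V) :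
    ∑ x, B.rootedHomSum K r (a x) = B.homCount G := by
  unfold rootedHomSum
  rw [homCount_eq_sum, Finset.sum_comm]
  have hinner : ∀ f : V → X', (∑ x, if f r = a x then ∏ e, K.mult ((B.inc e).image f) else 0) =
      if f r ∈ Set.range a then ∏ e, K.mult ((B.inc e).image f) else 0 := by
    intro f
    by_cases hfr : f r ∈ Set.range a
    · rw [if_pos hfr]
      obtain ⟨x, hx⟩ := hfr
      simp [← hx]
    · rw [if_neg hfr]
      exact Finset.sum_eq_zero fun x _ => if_neg fun hx => hfr ⟨x, hx.symm⟩
  rw [Finset.sum_congr rfl fun f _ => hinner f]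
  symm
  refine Finset.sum_of_injOn (fun f : V → X => a ∘ f) (a.injective.comp_left.injOn)
    (fun _ _ => Finset.mem_coe.2 (Finset.mem_univ _)) (fun f _ hf => ?_) fun f _ => ?_
  · by_contra hne
    have hfr : f r ∈ Set.range a := by
      by_contra hfr
      exact hne (if_neg hfr)
    rw [if_pos hfr, ← ne_eq, Finset.prod_ne_zero_iff] at hne
    have hmult : ∀ e, ∃ g, K.inc g = (B.inc e).image f := by
      intro e
      by_contra hg
      refine hne e (Finset.mem_univ e) (Finset.sum_eq_zero fun g _ => if_neg fun hg' => hg ⟨g, hg'⟩)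
    choose f' hf' using h.mem_range_of_connected hB hmult hfr
    exact hf ⟨f', Finset.mem_coe.2 (Finset.mem_univ _), funext hf'⟩
  · rw [if_pos ⟨f r, rfl⟩]
    refine Finset.prod_congr rfl fun e _ => ?_
    rw [← h.mult_map, Finset.map_eq_image, Finset.image_image]

theorem not_crDistinguishes_of_homCount_eq (G : IncHypergraph X F) (H : IncHypergraph X' F')
    (hGH : ∀ (V E : Type) [Fintype V] [Fintype E] (B : IncHypergraph V E),
      B.IsConnected → B.IsBergeAcyclic → B.homCount G = B.homCount H) :
    ¬ G.CRDistinguishes H := by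
  let K := G.disjointUnion H
  have hsum : ∀ φ ∈ Submodule.span ℚ {φ | K.TreeFunction φ},
      ∑ x, φ (Sum.inl x) = ∑ y, φ (Sum.inr y) := by
    intro φ hφ
    induction hφ using Submodule.span_induction with
    | mem φ hφ =>
      obtain ⟨V, E, _, _, B, r, hB, hcard, rfl⟩ := TreeFunction.exists_rootedHomSum hφ
      have h1 := (disjointUnion_inl G H).sum_rootedHomSum hB r
      have h2 := (disjointUnion_inr G H).sum_rootedHomSum hB r
      rw [← hGH V E B hB (hB.isBergeAcyclic_of_card hcard)] at h2
      exact h1.trans h2.symm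
    | zero => simp
    | add φ ψ _ _ h1 h2 => simp [Finset.sum_add_distrib, h1, h2]
    | smul a φ _ h1 => simp [← Finset.mul_sum, h1]
  -- Applying `hsum` to the indicator of a class compares its numbers of vertices in `G` and in `H`.
  have hclass : (univ : Finset X).val.map (fun x => K.treeClass (Sum.inl x)) =
      (univ : Finset X').val.map (fun y => K.treeClass (Sum.inr y)) := by
    ext S
    have h := hsum _ (K.indicator_mem_span_treeFunction S)
    rw [Finset.sum_boole, Finset.sum_boole] at h
    rw [Multiset.count_map, Multiset.count_map]
    simp only [eq_comm (a := S)]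
    exact_mod_cast h
  obtain ⟨σ, hσ⟩ := exists_equiv_of_map_univ_eq _ _ hclass
  rintro ⟨i, hi⟩
  refine hi ?_
  have hcol : H.color i ∘ σ = G.color i := by
    ext x
    rw [Function.comp_apply, ← (disjointUnion_inl G H).color_apply,
      ← (disjointUnion_inr G H).color_apply]
    exact K.color_eq_of_treeClass_eq i (hσ x)
  rw [← hcol, ← Multiset.map_map, Multiset.map_univ_val_equiv]

end Component

end IncHypergraph

theorem mainTheorem2 {VG EG VH EH : Type*} [Fintype VG] [Fintype EG] [Fintype VH] [Fintype EH]
    (G : IncHypergraph VG EG) (H : IncHypergraph VH EH) (hG : G.IsSimple) (hH : H.IsSimple) :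
    (∀ (V E : Type) [Fintype V] [Fintype E] (B : IncHypergraph V E),
        B.IsSimple → B.IsConnected → B.IsBergeAcyclic → B.homCount G = B.homCount H) ↔
      ¬ G.CRDistinguishes H := by
  classical
  constructor
  · intro h
    refine IncHypergraph.not_crDistinguishes_of_homCount_eq G H fun V E _ _ B hconn hacyc => ?_
    rw [← B.homCount_simplification hG, ← B.homCount_simplification hH]
    exact h _ _ B.simplification B.simplification_isSimple hconn.simplification
      hacyc.simplification
  · intro h V E _ _ B _ hconn hacyc
    have : Nonempty V := by
      obtain ⟨v | e⟩ := hconn.nonempty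
      · exact ⟨v⟩
      · exact (B.inc_nonempty e).to_subtype.map Subtype.val
    exact (IncHypergraph.hasLeafEdges_of_isBergeAcyclic hconn hacyc).homCount_eq G H h
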